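/- Let $\mathfrak D$ be the set of all $\rho\in M_3(\mathbb C)\otimes M_3(\mathbb C)$ such that $\rho=\rho^*$, $\operatorname{Tr}\rho=3$, $\rho$ is block-positive, i.e. $(x\otimes y,\rho\,(x\otimes y))\ge 0$ for all $x,y\in\mathbb C^3$, and $\alpha(\rho)=1$. Here $$\alpha(\rho)=\sup_{a\neq 0}\frac{|\operatorname{Tr}\rho a|}{\pi(a)},\qquad \pi(a)=\inf\Big\{\sum_i\|a_i\|\,\|b_i\|_1 \;:\; a=\sum_i a_i\otimes b_i\Big\},$$ where the supremum is over $a\in M_3(\mathbb C)\otimes M_3(\mathbb C)$, the infimum is over finite decompositions with $a_i,b_i\in M_3(\mathbb C)$, $\|\cdot\|$ is the operator norm and $\|b\|_1=\operatorname{Tr}(b^*b)^{1/2}$ is the trace norm. Let $s\in\mathfrak D$ be a symmetry, i.e. $s=s^*$ and $s^2=\mathbb 1$, and write $s=p-q$ with orthogonal projectors $p,q$ such that $p+q=\mathbb 1$. Then every normalized eigenvector $\xi\in\mathbb C^3\otimes\mathbb C^3$ of $q$ with nonzero eigenvalue (that is, every unit vector in the range of $q$) has Schmidt rank $2$ with both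 Schmidt coefficients equal to $1/\sqrt2$: there are orthonormal pairs $e_1,e_2$ and $f_1,f_2$ in $\mathbb C^3$ with $\xi=\tfrac1{\sqrt2}(e_1\otimes f_1+e_2\otimes f_2)$, and every Schmidt decomposition of $\xi$ (with orthonormal systems and positive coefficients) has exactly two terms, both with coefficient $1/\sqrt2$. -/

import Mathlib

open scoped Matrix Kronecker ComplexOrder MatrixOrder Matrix.Norms.L2Operator

namespace BlockPositive

noncomputable section

/-- `M_n ⊗ M_n`, realised through the Kronecker product as the algebra of matrices indexed by
pairs; `a ⊗ b` is `a ⊗ₖ b`. -/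
abbrev BiMatrix (n : ℕ) : Type := Matrix (Fin n × Fin n) (Fin n × Fin n) ℂ

/-- The Hilbert space `ℂⁿ ⊗ ℂⁿ`, realised as `ℂ^(n × n)` with its Euclidean norm. -/
abbrev BiVector (n : ℕ) : Type := EuclideanSpace ℂ (Fin n × Fin n)

/-- The product vector `x ⊗ y`. -/
def tensorVec {n : ℕ} (x y : EuclideanSpace ℂ (Fin n)) : BiVector n :=
  WithLp.toLp 2 fun i => x i.1 * y i.2

/-- `(x ⊗ y, ρ (x ⊗ y)) ≥ 0` for all `x, y ∈ ℂⁿ`. -/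
def IsBlockPositive {n : ℕ} (ρ : BiMatrix n) : Prop :=
  ∀ x y : EuclideanSpace ℂ (Fin n),
    0 ≤ inner ℂ (tensorVec x y) (Matrix.toEuclideanLin ρ (tensorVec x y))

/-- The trace norm `Tr |b|`, `|b| = (b* b)^(1/2)`. -/
def traceNorm {n : ℕ} (b : Matrix (Fin n) (Fin n) ℂ) : ℝ :=
  (CFC.sqrt (bᴴ * b)).trace.re

/-- The projective norm `π(x)`: the infimum of `∑ ‖aᵢ‖ ‖bᵢ‖₁` over all finite decompositions
`x = ∑ aᵢ ⊗ bᵢ`, with the operator norm on the first factor and the trace norm on the second. -/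
def projNorm {n : ℕ} (x : BiMatrix n) : ℝ :=
  sInf {r : ℝ | ∃ (k : ℕ) (a b : Fin k → Matrix (Fin n) (Fin n) ℂ),
    x = ∑ i, a i ⊗ₖ b i ∧ r = ∑ i, ‖a i‖ * traceNorm (b i)}

/-- The norm `α` dual to the projective norm under the pairing `(ρ, a) ↦ Tr (ρ a)`. -/
def alphaNorm {n : ℕ} (ρ : BiMatrix n) : ℝ :=
  sSup {r : ℝ | ∃ a : BiMatrix n, a ≠ 0 ∧ r = ‖(ρ * a).trace‖ / projNorm a}

/-- The set `𝔇` of the Choi matrices of normalised unital positive maps on `M_n`. -/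
def setD (n : ℕ) : Set (BiMatrix n) :=
  {ρ | ρ.IsHermitian ∧ alphaNorm ρ = 1 ∧ IsBlockPositive ρ ∧ ρ.trace = n}

/-- A symmetry is a selfadjoint unitary. -/
def IsSymmetry {n : ℕ} (s : BiMatrix n) : Prop :=
  s.IsHermitian ∧ s * s = 1

/-- `v = ∑ cᵢ eᵢ ⊗ fᵢ` is a Schmidt decomposition of `v`: the `eᵢ` are orthonormal, the `fᵢ` are
orthonormal and the `k` coefficients `cᵢ` are positive. Then `k` is the Schmidt rank of `v` and
the `cᵢ` are its Schmidt coefficients. -/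
structure IsSchmidtDecomposition {n k : ℕ} (v : BiVector n) (c : Fin k → ℝ)
    (e f : Fin k → EuclideanSpace ℂ (Fin n)) : Prop where
  coeff_pos : ∀ i, 0 < c i
  orthonormal_left : Orthonormal ℂ e
  orthonormal_right : Orthonormal ℂ f
  eq_sum : v = ∑ i, (c i : ℂ) • tensorVec (e i) (f i)

end

end BlockPositive

/-! Since `s = 1 - 2q` has trace 3 on a space of dimension 9, the range `W` of `q` has dimension 3.
Block-positivity says `‖q (x ⊗ y)‖² ≤ ‖x ⊗ y‖² / 2`, so the squared overlaps of orthonormal vectors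
of `W` with a unit product vector add up to at most `1/2`. A unit vector of `W` with singular
coefficient matrix has at most two nonzero Schmidt coefficients; their squares are at most `1/2` and
add up to 1, so both equal `1/2`. It remains to see that all of `W` is singular. A singular `v` in
`W` exhausts the bound on a family of product vectors, which forces every `w` in `W` orthogonal to
`v` to be singular too (`det_coeffMatrix_eq_zero_of_isSchmidtDecomposition`). Some nonzero singular
vector exists, and in dimension 3 singularity spreads from it to any vector through a common
orthogonal one. -/

namespace BlockPositive

/-! ### Product vectors and coefficient matrices. -/

/-- The matrix of coefficients of a vector of `ℂⁿ ⊗ ℂⁿ` in the standard product basis. -/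
def coeffMatrix {n : ℕ} : BiVector n →ₗ[ℂ] Matrix (Fin n) (Fin n) ℂ where
  toFun v := Matrix.of fun i j => v (i, j)
  map_add' _ _ := rfl
  map_smul' _ _ := rfl

lemma coeffMatrix_apply {n : ℕ} (v : BiVector n) (i j : Fin n) : coeffMatrix v i j = v (i, j) :=
  rfl

lemma inner_tensorVec_eq_sum {n : ℕ} (x y : EuclideanSpace ℂ (Fin n)) (v : BiVector n) :
    inner ℂ (tensorVec x y) v = ∑ i, ∑ j, star (x i) * coeffMatrix v i j * star (y j) := by
  simp only [PiLp.inner_apply, Fintype.sum_prod_type, tensorVec, coeffMatrix_apply]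
  refine Finset.sum_congr rfl fun i _ => Finset.sum_congr rfl fun j _ => ?_
  simp only [RCLike.inner_apply, map_mul, starRingEnd_apply]
  ring

/-- The inner product is antilinear in `y`, hence the conjugate of `y` on the right. -/
lemma inner_tensorVec_eq_inner {n : ℕ} (x y : EuclideanSpace ℂ (Fin n)) (v : BiVector n) :
    inner ℂ (tensorVec x y) v =
      inner ℂ x (WithLp.toLp 2 (coeffMatrix v *ᵥ star y.ofLp)) := by
  rw [inner_tensorVec_eq_sum]
  simp only [PiLp.inner_apply, RCLike.inner_apply, Matrix.mulVec, dotProduct, Finset.sum_mul,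
    starRingEnd_apply, Pi.star_apply]
  exact Finset.sum_congr rfl fun i _ => Finset.sum_congr rfl fun j _ => by ring

lemma inner_tensorVec_tensorVec {n : ℕ} (x y x' y' : EuclideanSpace ℂ (Fin n)) :
    inner ℂ (tensorVec x y) (tensorVec x' y') = inner ℂ x x' * inner ℂ y y' := by
  rw [inner_tensorVec_eq_sum]
  simp only [PiLp.inner_apply, RCLike.inner_apply, starRingEnd_apply, Finset.sum_mul_sum,
    coeffMatrix_apply, tensorVec]
  exact Finset.sum_congr rfl fun i _ => Finset.sum_congr rfl fun j _ => by ring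

lemma inner_self_eq_ofReal_norm_sq {E : Type*} [NormedAddCommGroup E] [InnerProductSpace ℂ E]
    (v : E) : inner ℂ v v = ((‖v‖ ^ 2 : ℝ) : ℂ) := by
  rw [inner_self_eq_norm_sq_to_K, Complex.ofReal_pow]
  rfl

lemma norm_tensorVec {n : ℕ} (x y : EuclideanSpace ℂ (Fin n)) :
    ‖tensorVec x y‖ = ‖x‖ * ‖y‖ := by
  have h := inner_tensorVec_tensorVec x y x y
  rw [inner_self_eq_ofReal_norm_sq, inner_self_eq_ofReal_norm_sq, inner_self_eq_ofReal_norm_sq,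
    ← Complex.ofReal_mul, ← mul_pow] at h
  exact (sq_eq_sq₀ (norm_nonneg _) (by positivity)).1 (Complex.ofReal_injective h)

/-- The trace of an orthogonal projector is the dimension of its range. -/
lemma finrank_range_toEuclideanLin {m : Type*} [Fintype m] [DecidableEq m] {q : Matrix m m ℂ}
    (hq : q * q = q) :
    (Module.finrank ℂ (LinearMap.range (Matrix.toEuclideanLin q)) : ℂ) = q.trace := by
  have hidem : IsIdempotentElem (Matrix.toEuclideanLin q) := by
    ext v : 1
    simp [Matrix.toLpLin_apply, Matrix.mulVec_mulVec, hq]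
  have h := (LinearMap.IsIdempotentElem.isProj_range _ hidem).trace
  rw [← h]
  rw [Matrix.toEuclideanLin_eq_toLin_orthonormal, Matrix.trace_toLin_eq]

/-! ### Singular vectors and Schmidt expansions. -/

/-- A subspace of dimension at least two contains a nonzero vector with singular coefficient
matrix. -/
lemma exists_det_coeffMatrix_eq_zero {n : ℕ} (hn : n ≠ 0) {W : Submodule ℂ (BiVector n)}
    (hW : 2 ≤ Module.finrank ℂ W) :
    ∃ v ∈ W, v ≠ 0 ∧ (coeffMatrix v).det = 0 := by
  obtain ⟨b, hb⟩ := exists_linearIndependent_pair_of_one_lt_finrank (R := ℂ) (M := W)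
    (by omega) (x := (Module.finBasis ℂ W) ⟨0, by omega⟩) ((Module.finBasis ℂ W).ne_zero _)
  set a := (Module.finBasis ℂ W) ⟨0, by omega⟩
  by_cases hdet : (coeffMatrix (b : BiVector n)).det = 0
  · exact ⟨b, b.2, by simpa using (hb.ne_zero 1), hdet⟩
  have : NeZero n := ⟨hn⟩
  have : Nonempty (Fin n) := ⟨0⟩
  -- With `A`, `B` the coefficient matrices of `a`, `b`, an eigenvalue `t` of `B⁻¹A` makes `A - tB`
  -- singular.
  obtain ⟨t, ht⟩ := spectrum.nonempty_of_isAlgClosed_of_finiteDimensional ℂ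
    ((coeffMatrix (b : BiVector n))⁻¹ * coeffMatrix (a : BiVector n))
  refine ⟨a - t • b, W.sub_mem a.2 (W.smul_mem t b.2), fun h0 => ?_, ?_⟩
  · have := LinearIndependent.pair_iff.1 hb 1 (-t) (by
      apply Subtype.ext
      simpa [sub_eq_add_neg] using h0)
    simp at this
  · rw [spectrum.mem_iff, Matrix.isUnit_iff_isUnit_det, isUnit_iff_ne_zero, not_not] at ht
    have hf : coeffMatrix ((a : BiVector n) - t • (b : BiVector n)) =
        -(coeffMatrix (b : BiVector n) * (algebraMap ℂ (Matrix (Fin n) (Fin n) ℂ) t -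
          (coeffMatrix (b : BiVector n))⁻¹ * coeffMatrix (a : BiVector n))) := by
      rw [mul_sub, ← mul_assoc, Matrix.mul_nonsing_inv _ (isUnit_iff_ne_zero.2 hdet), one_mul,
        map_sub, map_smul, Algebra.algebraMap_eq_smul_one, mul_smul_comm, mul_one, neg_sub]
    rw [hf, Matrix.det_neg, Matrix.det_mul, ht, mul_zero, mul_zero]

/-- Every vector is a sum of product vectors with orthogonal left factors and orthonormal right
factors. -/
lemma exists_schmidt_expansion {n : ℕ} (v : BiVector n) :
    ∃ (l : Fin n → ℝ) (u g : Fin n → EuclideanSpace ℂ (Fin n)),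
      Orthonormal ℂ g ∧ (∀ i j, inner ℂ (u i) (u j) = if i = j then (l i : ℂ) else 0) ∧
      v = ∑ i, tensorVec (u i) (g i) ∧ ((coeffMatrix v).det = 0 → ∃ i, l i = 0) := by
  set X := coeffMatrix v with hX
  have hA : (Xᴴ * X).IsHermitian := Matrix.isHermitian_conjTranspose_mul_self X
  set f := hA.eigenvectorBasis with hf
  have hfi : ∀ i j, star (f i).ofLp ⬝ᵥ (f j).ofLp = if i = j then 1 else 0 := by
    intro i j
    have := orthonormal_iff_ite.1 f.orthonormal i j
    rwa [EuclideanSpace.inner_eq_star_dotProduct, dotProduct_comm] at this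
  -- The `l k` are squared singular values. The left factors stay unnormalised, so vanishing ones
  -- need no separate case.
  refine ⟨hA.eigenvalues, fun k => WithLp.toLp 2 (X *ᵥ (f k).ofLp),
    fun k => WithLp.toLp 2 (star (f k).ofLp), ?_, ?_, ?_, ?_⟩
  · rw [orthonormal_iff_ite]
    intro i j
    rw [EuclideanSpace.inner_eq_star_dotProduct]
    simp only [star_star]
    rw [hfi j i]
    simp [eq_comm]
  · intro i j
    rw [EuclideanSpace.inner_eq_star_dotProduct, dotProduct_comm, Matrix.star_mulVec,
      ← Matrix.dotProduct_mulVec, Matrix.mulVec_mulVec, hA.mulVec_eigenvectorBasis,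
      dotProduct_smul, hfi]
    split_ifs with h
    · subst h; simp
    · simp
  · have hc : ∀ m j, ∑ k, f k m * star (f k j) = if m = j then 1 else 0 := by
      intro m j
      have h := f.sum_inner_mul_inner (EuclideanSpace.single m (1 : ℂ))
        (EuclideanSpace.single j (1 : ℂ))
      simp only [EuclideanSpace.inner_single_left, EuclideanSpace.inner_single_right] at h
      simpa [eq_comm] using h
    ext ⟨i, j⟩
    simp only [tensorVec, WithLp.ofLp_sum, Finset.sum_apply, Pi.star_apply, Matrix.mulVec,
      dotProduct, Finset.sum_mul]
    rw [Finset.sum_comm]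
    simp only [mul_assoc, ← Finset.mul_sum, hc]
    simp [hX, coeffMatrix_apply]
  · intro h0
    have h1 : (Xᴴ * X).det = 0 := by rw [Matrix.det_mul, h0, mul_zero]
    rw [hA.det_eq_prod_eigenvalues, Finset.prod_eq_zero_iff] at h1
    obtain ⟨i, -, hi⟩ := h1
    exact ⟨i, Complex.ofReal_injective hi⟩

/-! ### Consequences of the overlap bounds. -/

/-- A unit vector of `ℂ³ ⊗ ℂ³` with singular coefficient matrix whose squared overlaps with unit
product vectors are at most `1/2` is maximally entangled of Schmidt rank two. -/
lemma exists_isSchmidtDecomposition {v : BiVector 3} (hv : ‖v‖ = 1)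
    (hdet : (coeffMatrix v).det = 0)
    (hb : ∀ x y, ‖inner ℂ (tensorVec x y) v‖ ^ 2 ≤ 1 / 2 * (‖x‖ * ‖y‖) ^ 2) :
    ∃ e f : Fin 2 → EuclideanSpace ℂ (Fin 3),
      IsSchmidtDecomposition v (fun _ => 1 / Real.sqrt 2) e f := by
  obtain ⟨l, u, g, hg, hu, hsum, h0⟩ := exists_schmidt_expansion v
  obtain ⟨i₀, hi₀⟩ := h0 hdet
  have hnu : ∀ i, l i = ‖u i‖ ^ 2 := fun i => by
    have h := hu i i
    rw [inner_self_eq_ofReal_norm_sq, if_pos rfl] at h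
    exact Complex.ofReal_injective h.symm
  have hin : ∀ i, inner ℂ (tensorVec (u i) (g i)) v = (l i : ℂ) := fun i => by
    rw [hsum, inner_sum]
    simp [inner_tensorVec_tensorVec, hu, orthonormal_iff_ite.1 hg]
  -- As `‖u i‖² = l i`, the bound reads `l i ^ 2 ≤ l i / 2`.
  have hle : ∀ i, l i ≤ 1 / 2 := fun i => by
    have h := hb (u i) (g i)
    rw [hin, hg.1 i, mul_one, ← hnu, Complex.norm_real, Real.norm_eq_abs, sq_abs] at h
    nlinarith [sq_nonneg ‖u i‖, hnu i]
  have htot : ∑ i, l i = 1 := by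
    have h : inner ℂ v v = ((∑ i, l i : ℝ) : ℂ) := by
      nth_rewrite 1 [hsum]
      simp [hin]
    rw [inner_self_eq_ofReal_norm_sq, hv, one_pow] at h
    exact (Complex.ofReal_injective h).symm
  rw [Fin.sum_univ_succAbove _ i₀, hi₀, zero_add] at htot
  have hhalf : ∀ j : Fin 2, l (i₀.succAbove j) = 1 / 2 := by
    rw [Fin.sum_univ_two] at htot
    have h0 := hle (i₀.succAbove 0)
    have h1 := hle (i₀.succAbove 1)
    intro j
    fin_cases j
    · change l (i₀.succAbove 0) = _; linarith
    · change l (i₀.succAbove 1) = _; linarith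
  have hs : ((Real.sqrt 2 : ℝ) : ℂ) * (Real.sqrt 2 : ℝ) = 2 := by
    norm_cast; simp
  have hs0 : ((Real.sqrt 2 : ℝ) : ℂ) ≠ 0 := by
    intro h; rw [h] at hs; norm_num at hs
  refine ⟨fun j => ((Real.sqrt 2 : ℝ) : ℂ) • u (i₀.succAbove j), fun j => g (i₀.succAbove j),
    fun _ => by positivity, ?_, hg.comp _ Fin.succAbove_right_injective, ?_⟩
  · rw [orthonormal_iff_ite]
    intro i j
    rw [inner_smul_left, inner_smul_right, hu, Complex.conj_ofReal, ← mul_assoc, hs, hhalf]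
    simp [Fin.succAbove_right_injective.eq_iff]
  · have hu0 : u i₀ = 0 := by
      have := hnu i₀
      rw [hi₀] at this
      simpa using this.symm
    have ht0 : tensorVec (u i₀) (g i₀) = 0 := by
      rw [← norm_eq_zero, norm_tensorVec, hu0, norm_zero, zero_mul]
    rw [hsum, Fin.sum_univ_succAbove _ i₀, ht0, zero_add]
    refine Finset.sum_congr rfl fun j _ => ?_
    ext k
    simp only [tensorVec, PiLp.smul_apply, smul_eq_mul]
    push_cast
    field_simp

/-- If `v` is orthogonal to all products from two orthonormal pairs, its coefficient matrix is
singular. -/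
lemma det_coeffMatrix_eq_zero_of_inner_eq_zero {v : BiVector 3}
    {e f : Fin 2 → EuclideanSpace ℂ (Fin 3)} (he : Orthonormal ℂ e) (hf : Orthonormal ℂ f)
    (h : ∀ i j, inner ℂ (tensorVec (e i) (f j)) v = 0) : (coeffMatrix v).det = 0 := by
  let T : EuclideanSpace ℂ (Fin 3) →ₗ[ℂ] EuclideanSpace ℂ (Fin 3) :=
    Matrix.toEuclideanLin (coeffMatrix v)
  let g : Fin 2 → EuclideanSpace ℂ (Fin 3) := fun j => WithLp.toLp 2 (star (f j).ofLp)
  have hg : Orthonormal ℂ g := by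
    rw [orthonormal_iff_ite] at hf ⊢
    intro i j
    have := hf j i
    rw [EuclideanSpace.inner_eq_star_dotProduct] at this ⊢
    simpa [g, eq_comm, dotProduct_comm] using this
  have hT : ∀ i j, inner ℂ (e i) (T (g j)) = 0 := fun i j => by
    rw [← h i j, inner_tensorVec_eq_inner]
    rfl
  -- The source has dimension 4 and the target 3. Since `T` sends the span of `g` into the
  -- orthogonal complement of the `e i`, a kernel element has `a = 0`, and `b` yields a null vector
  -- of `T`.
  let F : (Fin 2 → ℂ) × (Fin 2 → ℂ) →ₗ[ℂ] EuclideanSpace ℂ (Fin 3) :=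
    (Fintype.linearCombination ℂ e).coprod (T ∘ₗ Fintype.linearCombination ℂ g)
  have hF : LinearMap.ker F ≠ ⊥ := LinearMap.ker_ne_bot_of_finrank_lt (by simp)
  obtain ⟨⟨a, b⟩, hab, hne⟩ := (Submodule.ne_bot_iff _).1 hF
  have hab' : ∑ i, a i • e i + T (∑ i, b i • g i) = 0 := by
    simpa [F, Fintype.linearCombination_apply] using hab
  have ha : a = 0 := by
    funext i
    have := congrArg (inner ℂ (e i)) hab'
    rw [inner_add_right, he.inner_right_fintype, map_sum, inner_sum, inner_zero_right] at this
    simpa [inner_smul_right, hT] using this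
  have hb : b ≠ 0 := by
    rintro rfl
    exact hne (by rw [ha]; rfl)
  rw [ha] at hab'
  rw [← Matrix.exists_mulVec_eq_zero_iff]
  refine ⟨(∑ i, b i • g i).ofLp, fun h0 => hb ?_, ?_⟩
  · have h0' : ∑ i, b i • g i = 0 := by
      ext k
      exact congrFun h0 k
    funext i
    exact Fintype.linearIndependent_iff.1 hg.linearIndependent b h0' i
  · have : T (∑ i, b i • g i) = 0 := by simpa using hab'
    simpa [T, Matrix.toLpLin_apply] using congrArg WithLp.ofLp this

/-- If `v` is maximally entangled of Schmidt rank two and the squared overlaps of `v` and `w` with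
unit product vectors add up to at most `1/2`, then `w` has a singular coefficient matrix. -/
lemma det_coeffMatrix_eq_zero_of_isSchmidtDecomposition {v w : BiVector 3}
    {e f : Fin 2 → EuclideanSpace ℂ (Fin 3)}
    (h : IsSchmidtDecomposition v (fun _ => 1 / Real.sqrt 2) e f)
    (hb : ∀ x y, ‖inner ℂ (tensorVec x y) v‖ ^ 2 + ‖inner ℂ (tensorVec x y) w‖ ^ 2 ≤
      1 / 2 * (‖x‖ * ‖y‖) ^ 2) : (coeffMatrix w).det = 0 := by
  have he := orthonormal_iff_ite.1 h.orthonormal_left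
  have hf := orthonormal_iff_ite.1 h.orthonormal_right
  -- On these product vectors `v` alone attains the bound, leaving no room for `w`.
  have key : ∀ a b : ℂ, inner ℂ (tensorVec (a • e 0 + b • e 1) (star a • f 0 + star b • f 1)) w
      = 0 := by
    intro a b
    have hx : ∀ (a b : ℂ) {e : Fin 2 → EuclideanSpace ℂ (Fin 3)},
        (∀ i j, inner ℂ (e i) (e j) = if i = j then (1 : ℂ) else 0) →
        ‖a • e 0 + b • e 1‖ ^ 2 = ‖a‖ ^ 2 + ‖b‖ ^ 2 := by
      intro a b e he
      apply Complex.ofReal_injective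
      rw [← inner_self_eq_ofReal_norm_sq]
      simp only [inner_add_left, inner_add_right, inner_smul_left, inner_smul_right, he]
      simp [Complex.mul_conj']
    have h1 := hb (a • e 0 + b • e 1) (star a • f 0 + star b • f 1)
    have h2 : inner ℂ (tensorVec (a • e 0 + b • e 1) (star a • f 0 + star b • f 1)) v =
        ((1 / Real.sqrt 2 * (‖a‖ ^ 2 + ‖b‖ ^ 2) : ℝ) : ℂ) := by
      rw [h.eq_sum, inner_sum]
      simp only [Fin.sum_univ_two, inner_smul_right, inner_tensorVec_tensorVec, inner_add_left,
        inner_smul_left, he, hf]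
      simp [Complex.conj_mul']
      ring
    rw [h2, mul_pow, hx a b he, hx _ _ hf, norm_star, norm_star, Complex.norm_real,
      Real.norm_eq_abs, sq_abs, mul_pow, div_pow, Real.sq_sqrt (by norm_num)] at h1
    have h3 : ‖inner ℂ (tensorVec (a • e 0 + b • e 1) (star a • f 0 + star b • f 1)) w‖ ^ 2
        ≤ 0 := by nlinarith
    simpa using le_antisymm h3 (by positivity)
  have expand : ∀ a b : ℂ,
      inner ℂ (tensorVec (a • e 0 + b • e 1) (star a • f 0 + star b • f 1)) w =
      star a * a * inner ℂ (tensorVec (e 0) (f 0)) w +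
      star a * b * inner ℂ (tensorVec (e 0) (f 1)) w +
      star b * a * inner ℂ (tensorVec (e 1) (f 0)) w +
      star b * b * inner ℂ (tensorVec (e 1) (f 1)) w := by
    intro a b
    simp only [inner_tensorVec_eq_sum, Finset.mul_sum, ← Finset.sum_add_distrib]
    refine Finset.sum_congr rfl fun i _ => Finset.sum_congr rfl fun j _ => ?_
    simp only [PiLp.add_apply, PiLp.smul_apply, smul_eq_mul, star_add, star_mul', star_star]
    ring
  simp only [expand] at key
  -- Polarisation: four choices of `(a, b)` isolate the four overlaps of `w` with the `e i ⊗ f j`.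
  have k1 := key 1 0
  have k2 := key 0 1
  have k3 := key 1 1
  have k4 := key 1 Complex.I
  simp at k1 k2
  simp [k1, k2] at k3 k4
  have hI : Complex.I * Complex.I = -1 := Complex.I_mul_I
  have k5 : inner ℂ (tensorVec (e 0) (f 1)) w = 0 := by
    linear_combination (1 / 2) * k3 - (Complex.I / 2) * k4 +
      (inner ℂ (tensorVec (e 0) (f 1)) w - inner ℂ (tensorVec (e 1) (f 0)) w) / 2 * hI
  rw [k5, zero_add] at k3
  refine det_coeffMatrix_eq_zero_of_inner_eq_zero h.orthonormal_left h.orthonormal_right ?_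
  intro i j
  fin_cases i <;> fin_cases j <;> assumption

/-- Every Schmidt decomposition of a unit vector of `ℂ³ ⊗ ℂ³` with singular coefficient matrix and
squared overlaps with unit product vectors at most `1/2` has two terms with equal coefficients. -/
lemma IsSchmidtDecomposition.eq_two {v : BiVector 3} (hv : ‖v‖ = 1)
    (hdet : (coeffMatrix v).det = 0)
    (hb : ∀ x y, ‖inner ℂ (tensorVec x y) v‖ ^ 2 ≤ 1 / 2 * (‖x‖ * ‖y‖) ^ 2)
    {k : ℕ} {c : Fin k → ℝ} {e f : Fin k → EuclideanSpace ℂ (Fin 3)}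
    (h : IsSchmidtDecomposition v c e f) : k = 2 ∧ ∀ i, c i = 1 / Real.sqrt 2 := by
  have he := orthonormal_iff_ite.1 h.orthonormal_left
  have hf := orthonormal_iff_ite.1 h.orthonormal_right
  have hin : ∀ i, inner ℂ (tensorVec (e i) (f i)) v = (c i : ℂ) := fun i => by
    rw [h.eq_sum, inner_sum]
    simp [inner_tensorVec_tensorVec, he, hf]
  have hle : ∀ i, c i ^ 2 ≤ 1 / 2 := fun i => by
    have := hb (e i) (f i)
    rwa [hin, h.orthonormal_left.1 i, h.orthonormal_right.1 i, Complex.norm_real,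
      Real.norm_eq_abs, sq_abs, mul_one, one_pow, mul_one] at this
  have htot : ∑ i, c i ^ 2 = 1 := by
    have h' : inner ℂ v v = ((∑ i, c i ^ 2 : ℝ) : ℂ) := by
      nth_rewrite 1 [h.eq_sum]
      simp [hin, sq]
    rw [inner_self_eq_ofReal_norm_sq, hv, one_pow] at h'
    exact (Complex.ofReal_injective h').symm
  have hk3 : k ≤ 3 := by
    simpa using h.orthonormal_left.linearIndependent.fintype_card_le_finrank
  have hk2 : 2 ≤ k := by
    have := Finset.sum_le_card_nsmul Finset.univ (fun i => c i ^ 2) (1 / 2) fun i _ => hle i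
    rw [htot] at this
    simp at this
    have : (2 : ℝ) ≤ k := by linarith
    exact_mod_cast this
  -- Three positive terms would make the coefficient matrix a product of invertible matrices.
  have hkne : k ≠ 3 := by
    rintro rfl
    have hdetne : ∀ {e : Fin 3 → EuclideanSpace ℂ (Fin 3)}, Orthonormal ℂ e →
        (Matrix.of fun k i => e k i).det ≠ 0 := by
      intro e he h0
      obtain ⟨a, ha, ha0⟩ := Matrix.exists_vecMul_eq_zero_iff.2 h0
      refine ha (funext fun i => Fintype.linearIndependent_iff.1 he.linearIndependent a ?_ i)
      ext j
      simpa [Matrix.vecMul, dotProduct] using congrFun ha0 j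
    have hfac : coeffMatrix v = (Matrix.of fun k i => e k i)ᵀ *
        Matrix.diagonal (fun i => (c i : ℂ)) * (Matrix.of fun k i => f k i) := by
      ext i j
      rw [coeffMatrix_apply, h.eq_sum, Matrix.mul_apply]
      simp only [Matrix.mul_diagonal, Matrix.transpose_apply, Matrix.of_apply, WithLp.ofLp_sum,
        Finset.sum_apply, tensorVec, PiLp.smul_apply, smul_eq_mul]
      exact Finset.sum_congr rfl fun _ _ => by ring
    rw [hfac, Matrix.det_mul, Matrix.det_mul, Matrix.det_transpose, Matrix.det_diagonal] at hdet
    refine mul_ne_zero (mul_ne_zero (hdetne h.orthonormal_left) ?_) (hdetne h.orthonormal_right)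
      hdet
    exact Finset.prod_ne_zero_iff.2 fun i _ => by exact_mod_cast (h.coeff_pos i).ne'
  obtain rfl : k = 2 := by omega
  refine ⟨rfl, fun i => ?_⟩
  have hsq : c i ^ 2 = 1 / 2 := by
    rw [Fin.sum_univ_two] at htot
    have h0 := hle 0
    have h1 := hle 1
    fin_cases i
    · change c 0 ^ 2 = _; linarith
    · change c 1 ^ 2 = _; linarith
  rw [← Real.sqrt_sq (h.coeff_pos i).le, hsq, Real.sqrt_div zero_le_one, Real.sqrt_one]

/-- In a three-dimensional space of vectors such that the squared overlaps of unit product vectors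
with orthonormal pairs add up to at most `1/2`, every coefficient matrix is singular. -/
lemma det_coeffMatrix_eq_zero_of_finrank_eq_three {W : Submodule ℂ (BiVector 3)}
    (hW : Module.finrank ℂ W = 3)
    (hb : ∀ v ∈ W, ∀ w ∈ W, ‖v‖ = 1 → ‖w‖ = 1 → inner ℂ v w = 0 → ∀ x y,
      ‖inner ℂ (tensorVec x y) v‖ ^ 2 + ‖inner ℂ (tensorVec x y) w‖ ^ 2 ≤
        1 / 2 * (‖x‖ * ‖y‖) ^ 2) :
    ∀ v ∈ W, (coeffMatrix v).det = 0 := by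
  have hscale : ∀ (a : ℂ) (v : BiVector 3), a ≠ 0 →
      ((coeffMatrix (a • v)).det = 0 ↔ (coeffMatrix v).det = 0) := by
    intro a v ha
    simp [ha]
  have horth : ∀ v ∈ W, v ≠ 0 → (coeffMatrix v).det = 0 → ∀ w ∈ W, inner ℂ v w = 0 →
      (coeffMatrix w).det = 0 := by
    intro v hv hv0 hdet w hw hvw
    rcases eq_or_ne w 0 with rfl | hw0
    · simp
    have hnv : (‖v‖⁻¹ : ℂ) ≠ 0 := by simpa using hv0
    have hnw : (‖w‖⁻¹ : ℂ) ≠ 0 := by simpa using hw0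
    have hb' := hb _ (W.smul_mem _ hv) _ (W.smul_mem _ hw)
      (norm_smul_inv_norm (𝕜 := ℂ) hv0) (norm_smul_inv_norm (𝕜 := ℂ) hw0)
      (by rw [inner_smul_left, inner_smul_right, hvw, mul_zero, mul_zero])
    obtain ⟨e, f, hef⟩ := exists_isSchmidtDecomposition (norm_smul_inv_norm (𝕜 := ℂ) hv0)
      ((hscale _ _ hnv).2 hdet) fun x y => le_trans (le_add_of_nonneg_right (by positivity))
        (hb' x y)
    exact (hscale _ _ hnw).1 (det_coeffMatrix_eq_zero_of_isSchmidtDecomposition hef hb')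
  obtain ⟨v₀, hv₀, hne, hdet⟩ := exists_det_coeffMatrix_eq_zero three_ne_zero
    (W := W) (by omega)
  intro v hv
  -- As `dim W = 3`, some nonzero `z` in `W` is orthogonal to both `v₀` and `v`; singularity passes
  -- from `v₀` to `z`, then to `v`.
  let F : W →ₗ[ℂ] ℂ × ℂ :=
    ((innerSL ℂ v₀).toLinearMap.prod (innerSL ℂ v).toLinearMap) ∘ₗ W.subtype
  have hF : LinearMap.ker F ≠ ⊥ := LinearMap.ker_ne_bot_of_finrank_lt (by simp [hW])
  obtain ⟨z, hz, hz0⟩ := (Submodule.ne_bot_iff _).1 hF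
  have hz' : inner ℂ v₀ (z : BiVector 3) = 0 ∧ inner ℂ v (z : BiVector 3) = 0 := by
    simpa [F] using hz
  have hz0' : (z : BiVector 3) ≠ 0 := by simpa using hz0
  exact horth z z.2 hz0' (horth v₀ hv₀ hne hdet z z.2 hz'.1) v hv (inner_eq_zero_symm.1 hz'.2)

/-! ### From block-positivity to the overlap bounds. -/

/-- If `1 - 2q` is block-positive, then `‖q (x ⊗ y)‖² ≤ ‖x ⊗ y‖² / 2`. -/
lemma norm_sq_toEuclideanLin_tensorVec_le {n : ℕ} {q : BiMatrix n} (hq : IsStarProjection q)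
    (h : IsBlockPositive (1 - 2 • q)) (x y : EuclideanSpace ℂ (Fin n)) :
    ‖Matrix.toEuclideanLin q (tensorVec x y)‖ ^ 2 ≤ 1 / 2 * (‖x‖ * ‖y‖) ^ 2 := by
  have h1 := h x y
  set w := tensorVec x y with hw
  have hqq : inner ℂ w (Matrix.toEuclideanLin q w) =
      inner ℂ (Matrix.toEuclideanLin q w) (Matrix.toEuclideanLin q w) := by
    have hsym := Matrix.isSymmetric_toEuclideanLin_iff.2 (show q.IsHermitian from hq.2)
    rw [hsym]
    congr 1
    simp [Matrix.toLpLin_apply, Matrix.mulVec_mulVec, hq.1.eq]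
  rw [map_sub, map_nsmul, LinearMap.sub_apply, LinearMap.smul_apply, inner_sub_right,
    two_smul, inner_add_right, hqq] at h1
  have h2 : Matrix.toEuclideanLin (1 : BiMatrix n) w = w := by simp
  rw [h2, inner_self_eq_ofReal_norm_sq, inner_self_eq_ofReal_norm_sq] at h1
  have h3 : (0 : ℝ) ≤ ‖w‖ ^ 2 - (‖Matrix.toEuclideanLin q w‖ ^ 2 +
      ‖Matrix.toEuclideanLin q w‖ ^ 2) := by exact_mod_cast h1
  rw [← norm_tensorVec, ← hw]
  linarith

end BlockPositive

theorem mainTheorem9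
    (s p q : BlockPositive.BiMatrix 3)
    (hs : BlockPositive.IsSymmetry s)
    (hD : s ∈ BlockPositive.setD 3)
    (hp : IsStarProjection p) (hq : IsStarProjection q)
    (hpq : p + q = 1) (hspq : s = p - q)
    (μ : ℂ) (hμ : μ ≠ 0)
    (ξ : BlockPositive.BiVector 3)
    (hξ : Module.End.HasEigenvector (Matrix.toEuclideanLin q) μ ξ)
    (hnorm : ‖ξ‖ = 1) :
    (∃ e f : Fin 2 → EuclideanSpace ℂ (Fin 3),
      BlockPositive.IsSchmidtDecomposition ξ (fun _ => 1 / Real.sqrt 2) e f) ∧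
    (∀ (k : ℕ) (c : Fin k → ℝ) (e f : Fin k → EuclideanSpace ℂ (Fin 3)),
      BlockPositive.IsSchmidtDecomposition ξ c e f →
        k = 2 ∧ ∀ i, c i = 1 / Real.sqrt 2) := by
  obtain ⟨-, -, hbp, htr⟩ := hD
  have hs2 : s = 1 - 2 • q := by rw [hspq, ← hpq, two_smul]; abel
  rw [hs2] at hbp
  have hqtr : q.trace = 3 := by
    rw [hs2, Matrix.trace_sub, Matrix.trace_smul, Matrix.trace_one] at htr
    simp at htr
    linear_combination (-1 / 2) * htr
  have hproj := BlockPositive.norm_sq_toEuclideanLin_tensorVec_le hq hbp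
  set W := LinearMap.range (Matrix.toEuclideanLin q) with hWdef
  have hW : Module.finrank ℂ W = 3 := by
    have h := BlockPositive.finrank_range_toEuclideanLin hq.1.eq
    rw [hqtr] at h
    exact_mod_cast h
  have hsym := Matrix.isSymmetric_toEuclideanLin_iff.2 (show q.IsHermitian from hq.2)
  have hfix : ∀ v ∈ W, Matrix.toEuclideanLin q v = v := by
    rintro _ ⟨u, rfl⟩
    simp [Matrix.toLpLin_apply, Matrix.mulVec_mulVec, hq.1.eq]
  -- Overlaps with `x ⊗ y` become overlaps with `q (x ⊗ y)`, so Cauchy–Schwarz and Bessel give the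
  -- bounds for one and two vectors.
  have hinner : ∀ v ∈ W, ∀ w, ‖inner ℂ w v‖ = ‖inner ℂ v (Matrix.toEuclideanLin q w)‖ := by
    intro v hv w
    rw [← hsym, hfix v hv, norm_inner_symm]
  have hone : ∀ v ∈ W, ‖v‖ = 1 → ∀ x y, ‖inner ℂ (BlockPositive.tensorVec x y) v‖ ^ 2 ≤
      1 / 2 * (‖x‖ * ‖y‖) ^ 2 := by
    intro v hv hv1 x y
    refine le_trans ?_ (hproj x y)
    rw [hinner v hv]
    gcongr
    simpa [hv1] using norm_inner_le_norm (𝕜 := ℂ) v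
      (Matrix.toEuclideanLin q (BlockPositive.tensorVec x y))
  have hpair : ∀ v ∈ W, ∀ w ∈ W, ‖v‖ = 1 → ‖w‖ = 1 → inner ℂ v w = 0 → ∀ x y,
      ‖inner ℂ (BlockPositive.tensorVec x y) v‖ ^ 2 +
        ‖inner ℂ (BlockPositive.tensorVec x y) w‖ ^ 2 ≤ 1 / 2 * (‖x‖ * ‖y‖) ^ 2 := by
    intro v hv w hw hv1 hw1 hvw x y
    refine le_trans ?_ (hproj x y)
    have ho : Orthonormal ℂ ![v, w] := by
      refine ⟨fun i => by fin_cases i <;> simpa, fun i j hij => ?_⟩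
      fin_cases i <;> fin_cases j <;>
        first | exact absurd rfl hij | exact hvw | exact inner_eq_zero_symm.1 hvw
    rw [hinner v hv, hinner w hw]
    simpa using ho.sum_inner_products_le (s := Finset.univ)
      (Matrix.toEuclideanLin q (BlockPositive.tensorVec x y))
  have hξW : ξ ∈ W := by
    refine ⟨μ⁻¹ • ξ, ?_⟩
    rw [map_smul, hξ.apply_eq_smul, smul_smul, inv_mul_cancel₀ hμ, one_smul]
  have hdet := BlockPositive.det_coeffMatrix_eq_zero_of_finrank_eq_three hW hpair ξ hξW
  exact ⟨BlockPositive.exists_isSchmidtDecomposition hnorm hdet (hone ξ hξW hnorm),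
    fun k c e f h => h.eq_two hnorm hdet (hone ξ hξW hnorm)⟩
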